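/- Let $(X,\mathcal A,m)$ be a $\sigma$-finite measure space and $L^2=L^2(X,m)$ the real Hilbert space with scalar product $(\cdot,\cdot)$. A (symmetric) Dirichlet form on $L^2$ is a nonnegative symmetric bilinear form $\mathcal E$ on a dense linear subspace $\mathcal D=\mathrm{dom}(\mathcal E)\subset L^2$ which is closed (with $\mathcal E[u]:=\mathcal E(u,u)$, the space $\mathcal D$ is complete for the norm $(\mathcal E[u]+\|u\|^2)^{1/2}$) and such that for every $u\in\mathcal D$ the function $u_{0,1}:=\min(\max(u,0),1)$ lies in $\mathcal D$ and $\mathcal E[u_{0,1}]\le\mathcal E[u]$. Its resolvent $(K_\alpha)_{\alpha>0}$ is given by: $K_\alpha f$ is the unique $u\in\mathcal D$ with $\mathcal E(u,v)+\alpha(u,v)=(f,v)$ for all $v\in\mathcal D$. Its semigroup $(T_t)_{t>0}$ on $L^2$ is $T_tf=\lim_{\beta\to\infty}e^{t\beta(\beta K_\beta-1)}f$, that is, $T_t=e^{-tA}$ for the nonnegative self-adjoint operator $A$ associated with $\mathcal E$. A set $Y\in\mathcal A$ is $T_t$-invariant (or invariant for $\mathcal E$) if $T_t(1_Yu)=1_YT_tu$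 for all $u\in L^2$ and some $t>0$; equivalently, for all $u\in L^2$ and every $t>0$. A sequence $(\mathcal E^k)_{k\in\mathbb N}$ of nonnegative quadratic forms with domains in a real Hilbert space $H$, extended by $+\infty$ off their domains, Mosco-converges to such a form $\mathcal E^\infty$ if (M1) $\liminf_{k\to\infty}\mathcal E^k[u_k]\ge\mathcal E^\infty[u]$ whenever $u_k\to u$ weakly in $H$, and (M2) for every $u\in H$ there are $u_k\in H$ with $u_k\to u$ strongly in $H$ and $\limsup_{k\to\infty}\mathcal E^k[u_k]\le\mathcal E^\infty[u]$. The part $\mathcal E^Y$ of $\mathcal E$ on an invariant set $Y$ is the quadratic form in $L^2(Y,m|_Y)$ with domain $\{u|_Y : u\in\mathcal D\}$ and $\mathcal E^Y[u|_Y]=\mathcal E[1_Yu]$ (if $Y$ is invariant, then $1_Yu\in\mathcal D$ for all $u\in\mathcal D$). **Theorem.** Let $(\mathcal E^k)_{k\in\mathbb N}$ be a sequence of Dirichlet forms on $L^2(X,m)$ that Mosco-converges in $L^2(X,m)$ to a Dirichlet form $\mathcal E^\infty$ on $L^2(X,m)$, with semigroups $(T^{(k)}_t)_{t>0}$ and $(T^\infty_t)_{t>0}$.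 Let $Y\in\mathcal A$ be such that for each $k$ there is some $t>0$ (possibly depending on $k$) with $T^{(k)}_t(1_Yu)=1_YT^{(k)}_tu$ for all $u\in L^2(X,m)$. Then (a) $Y$ is invariant for $\mathcal E^\infty$: $T^\infty_t(1_Yu)=1_YT^\infty_tu$ for all $u\in L^2(X,m)$ and every $t>0$; (b) the parts $(\mathcal E^k)^Y$ Mosco-converge to $(\mathcal E^\infty)^Y$ in $L^2(Y,m|_Y)$. -/

import Mathlib

open MeasureTheory Filter Topology
open scoped ENNReal RealInnerProductSpace

noncomputable section

/-! ## Quadratic forms with a domain in a real Hilbert space -/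

/-- A nonnegative quadratic form on a real Hilbert space `H`: a linear subspace of `H`, its domain,
with a nonnegative symmetric bilinear form `𝓔(u, v)` on it. The quadratic form is
`𝓔[u] = 𝓔(u, u)`. -/
structure FormOn (H : Type*) [NormedAddCommGroup H] [InnerProductSpace ℝ H] where
  domain : Submodule ℝ H
  bilin : domain →ₗ[ℝ] domain →ₗ[ℝ] ℝ
  symm : ∀ u v, bilin u v = bilin v u
  nonneg : ∀ u, 0 ≤ bilin u u

namespace FormOn

variable {H : Type*} [NormedAddCommGroup H] [InnerProductSpace ℝ H]

open Classical in
/-- The quadratic form `u ↦ 𝓔[u]`, extended to all of `H` by `+∞` off its domain. -/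
def energy (E : FormOn H) (u : H) : ℝ≥0∞ :=
  if h : u ∈ E.domain then ENNReal.ofReal (E.bilin ⟨u, h⟩ ⟨u, h⟩) else ⊤

/-- `𝓔` is closed: its domain is complete for the norm `(𝓔[u] + ‖u‖²)^{1/2}`. -/
def IsClosed (E : FormOn H) : Prop :=
  ∀ u : ℕ → E.domain,
    (∀ ε > 0, ∃ N, ∀ i ≥ N, ∀ j ≥ N,
      E.bilin (u i - u j) (u i - u j) + ‖(u i - u j : H)‖ ^ 2 < ε) →
    ∃ w : E.domain,
      Tendsto (fun i => E.bilin (u i - w) (u i - w) + ‖(u i - w : H)‖ ^ 2) atTop (𝓝 0)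

/-- The pull-back of a form along a linear map `j : K → H`: its domain is
`{w : j w ∈ domain 𝓔}` and its value there is `𝓔(j w, j w')`. -/
def comap {K : Type*} [NormedAddCommGroup K] [InnerProductSpace ℝ K]
    (E : FormOn H) (j : K →ₗ[ℝ] H) : FormOn K where
  domain := E.domain.comap j
  bilin := E.bilin.compl₁₂ (j.restrict fun _ h => h) (j.restrict fun _ h => h)
  symm _ _ := E.symm _ _
  nonneg _ := E.nonneg _

end FormOn

/-- Mosco convergence of a sequence of forms on `H`, for forms extended by `+∞` off
their domains. -/
structure MoscoConverges {H : Type*} [NormedAddCommGroup H] [InnerProductSpace ℝ H]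
    (E : ℕ → FormOn H) (Einf : FormOn H) : Prop where
  /-- The lower bound along weakly convergent sequences. -/
  liminf_ge : ∀ (u : ℕ → H) (v : H),
    Tendsto (fun k => toWeakSpace ℝ H (u k)) atTop (𝓝 (toWeakSpace ℝ H v)) →
    Einf.energy v ≤ liminf (fun k => (E k).energy (u k)) atTop
  /-- The existence of strongly convergent recovery sequences. -/
  limsup_le : ∀ v : H, ∃ u : ℕ → H, Tendsto u atTop (𝓝 v) ∧
    limsup (fun k => (E k).energy (u k)) atTop ≤ Einf.energy v

/-! ## Resolvent and semigroup of a closed form -/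

/-- The Riesz representation theorem in a space that is complete for a given scalar product. -/
theorem exists_riesz_of_complete {V : Type*} [AddCommGroup V] [Module ℝ V]
    (B : V →ₗ[ℝ] V →ₗ[ℝ] ℝ) (hsymm : ∀ u v, B u v = B v u)
    (hnonneg : ∀ u, 0 ≤ B u u) (hdef : ∀ u, B u u = 0 → u = 0)
    (hcomplete : ∀ u : ℕ → V,
      (∀ ε > 0, ∃ N, ∀ i ≥ N, ∀ j ≥ N, B (u i - u j) (u i - u j) < ε) →
      ∃ w, Tendsto (fun i => B (u i - w) (u i - w)) atTop (𝓝 0))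
    (l : V →ₗ[ℝ] ℝ) (C : ℝ) (hC : 0 ≤ C) (hl : ∀ v, l v ^ 2 ≤ C * B v v) :
    ∃ u, ∀ v, B u v = l v := by
  let c : InnerProductSpace.Core ℝ V :=
    { inner := fun u v => B u v
      conj_inner_symm := fun u v => by simpa using hsymm v u
      re_inner_nonneg := fun u => by simpa using hnonneg u
      add_left := fun u v w => by simp
      smul_left := fun u v r => by simp
      definite := fun u h => hdef u h }
  let _ : NormedAddCommGroup V := c.toNormedAddCommGroup
  let _ : InnerProductSpace ℝ V := InnerProductSpace.ofCore c.toCore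
  have hin : ∀ u v : V, ⟪u, v⟫ = B u v := fun _ _ => rfl
  have hnorm : ∀ u : V, B u u = ‖u‖ ^ 2 := fun u => by
    rw [← hin, real_inner_self_eq_norm_sq]
  have : CompleteSpace V := by
    refine Metric.complete_of_cauchySeq_tendsto fun u hu => ?_
    obtain ⟨w, hw⟩ := hcomplete u (by
      intro ε hε
      obtain ⟨N, hN⟩ := Metric.cauchySeq_iff.1 hu (Real.sqrt ε) (Real.sqrt_pos.2 hε)
      refine ⟨N, fun i hi j hj => ?_⟩
      have := hN i hi j hj
      rw [dist_eq_norm] at this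
      rw [hnorm]
      exact (Real.lt_sqrt (norm_nonneg _)).1 this)
    refine ⟨w, tendsto_iff_norm_sub_tendsto_zero.2 ?_⟩
    have h2 := (Real.continuous_sqrt.tendsto 0).comp hw
    simp only [Real.sqrt_zero] at h2
    refine h2.congr fun i => ?_
    rw [Function.comp_apply, hnorm, Real.sqrt_sq (norm_nonneg _)]
  let L : StrongDual ℝ V := l.mkContinuous (Real.sqrt C) fun v => by
    rw [Real.norm_eq_abs]
    refine abs_le_of_sq_le_sq ?_ (by positivity)
    rw [mul_pow, Real.sq_sqrt hC, ← hnorm]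
    exact hl v
  refine ⟨(InnerProductSpace.toDual ℝ V).symm L, fun v => ?_⟩
  rw [← hin, InnerProductSpace.toDual_symm_apply]
  rfl

namespace FormOn

variable {H : Type*} [NormedAddCommGroup H] [InnerProductSpace ℝ H]

/-- `u` solves `𝓔(u, v) + α (u, v) = (f, v)` for all `v` in the domain. -/
def IsResolventAt (E : FormOn H) (α : ℝ) (f u : H) : Prop :=
  ∃ h : u ∈ E.domain, ∀ v : E.domain, E.bilin ⟨u, h⟩ v + α * ⟪u, (v : H)⟫ = ⟪f, (v : H)⟫

theorem IsResolventAt.add {E : FormOn H} {α : ℝ} {f g u w : H}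
    (hu : E.IsResolventAt α f u) (hw : E.IsResolventAt α g w) :
    E.IsResolventAt α (f + g) (u + w) := by
  obtain ⟨h, hu⟩ := hu
  obtain ⟨h', hw⟩ := hw
  refine ⟨add_mem h h', fun v => ?_⟩
  have e : (⟨u + w, add_mem h h'⟩ : E.domain) = ⟨u, h⟩ + ⟨w, h'⟩ := rfl
  rw [e, map_add, LinearMap.add_apply, inner_add_left, inner_add_left, ← hu v, ← hw v]
  ring

theorem IsResolventAt.smul {E : FormOn H} {α : ℝ} {f u : H} (c : ℝ)
    (hu : E.IsResolventAt α f u) : E.IsResolventAt α (c • f) (c • u) := by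
  obtain ⟨h, hu⟩ := hu
  refine ⟨E.domain.smul_mem c h, fun v => ?_⟩
  have e : (⟨c • u, E.domain.smul_mem c h⟩ : E.domain) = c • ⟨u, h⟩ := rfl
  rw [e, map_smul, LinearMap.smul_apply, real_inner_smul_left, real_inner_smul_left, ← hu v,
    smul_eq_mul]
  ring

theorem IsResolventAt.norm_le {E : FormOn H} {α : ℝ} (hα : 0 < α) {f u : H}
    (hu : E.IsResolventAt α f u) : ‖u‖ ≤ α⁻¹ * ‖f‖ := by
  obtain ⟨h, hu⟩ := hu
  have h1 := hu ⟨u, h⟩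
  have h2 := E.nonneg ⟨u, h⟩
  have h3 := real_inner_le_norm f u
  simp only [real_inner_self_eq_norm_sq] at h1
  rcases (norm_nonneg u).eq_or_lt with h0 | h0
  · rw [← h0]; positivity
  · rw [inv_mul_eq_div, le_div_iff₀ hα]
    nlinarith

theorem IsResolventAt.unique {E : FormOn H} {α : ℝ} (hα : 0 < α) {f u w : H}
    (hu : E.IsResolventAt α f u) (hw : E.IsResolventAt α f w) : u = w := by
  have h := (hu.add (hw.smul (-1))).norm_le hα
  simp only [neg_smul, one_smul, add_neg_cancel, norm_zero, mul_zero] at h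
  have := norm_le_zero_iff.1 h
  rwa [← sub_eq_add_neg, sub_eq_zero] at this

theorem IsClosed.exists_isResolventAt {E : FormOn H} (hE : E.IsClosed) {α : ℝ} (hα : 0 < α)
    (f : H) : ∃ u, E.IsResolventAt α f u := by
  let B : E.domain →ₗ[ℝ] E.domain →ₗ[ℝ] ℝ :=
    E.bilin + α • (innerₗ H).compl₁₂ E.domain.subtype E.domain.subtype
  have hB : ∀ u v, B u v = E.bilin u v + α * ⟪(u : H), (v : H)⟫ := fun _ _ => rfl
  have hB' : ∀ u, B u u = E.bilin u u + α * ‖(u : H)‖ ^ 2 := fun u => by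
    rw [hB, real_inner_self_eq_norm_sq]
  obtain ⟨u, hu⟩ := exists_riesz_of_complete B
    (fun u v => by rw [hB, hB, E.symm, real_inner_comm])
    (fun u => by rw [hB']; have := E.nonneg u; positivity)
    (fun u h => by
      rw [hB'] at h
      have h1 := E.nonneg u
      have h2 : ‖(u : H)‖ ^ 2 = 0 := by
        by_contra hne
        have : 0 < ‖(u : H)‖ ^ 2 := lt_of_le_of_ne (sq_nonneg _) (Ne.symm hne)
        nlinarith [mul_pos hα this]
      exact Subtype.ext (norm_eq_zero.1 (pow_eq_zero_iff two_ne_zero |>.1 h2)))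
    (fun u hu => by
      set C := 1 + α⁻¹ with hC
      have hCpos : 0 < C := by positivity
      have hle : ∀ v : E.domain, E.bilin v v + ‖(v : H)‖ ^ 2 ≤ C * B v v := fun v => by
        rw [hB', hC]
        have h1 := E.nonneg v
        have h2 : α⁻¹ * (α * ‖(v : H)‖ ^ 2) = ‖(v : H)‖ ^ 2 := by field_simp
        have h3 : 0 ≤ α * ‖(v : H)‖ ^ 2 := by positivity
        have h4 : 0 ≤ α⁻¹ * E.bilin v v := by positivity
        nlinarith
      obtain ⟨w, hw⟩ := hE u (by
        intro ε hε
        obtain ⟨N, hN⟩ := hu (ε / C) (by positivity)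
        refine ⟨N, fun i hi j hj => ?_⟩
        have h1 := hN i hi j hj
        rw [lt_div_iff₀ hCpos] at h1
        have h2 := hle (u i - u j)
        push_cast at h2
        linarith)
      refine ⟨w, ?_⟩
      refine squeeze_zero (g := fun i => (1 + α) *
        (E.bilin (u i - w) (u i - w) + ‖(u i - w : H)‖ ^ 2)) ?_ ?_ ?_
      · intro i
        rw [hB']; have := E.nonneg (u i - w); positivity
      · intro i
        rw [hB']
        have h1 := E.nonneg (u i - w)
        push_cast
        nlinarith [sq_nonneg ‖(u i - w : H)‖, mul_nonneg hα.le h1]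
      · simpa using hw.const_mul (1 + α))
    ((innerₗ H f).comp E.domain.subtype) (α⁻¹ * ‖f‖ ^ 2) (by positivity)
    (fun v => by
      have h1 := E.nonneg v
      have h2 : ⟪f, (v : H)⟫ ^ 2 ≤ ‖f‖ ^ 2 * ‖(v : H)‖ ^ 2 := by
        rw [← mul_pow]
        exact sq_le_sq' (neg_le_of_abs_le (abs_real_inner_le_norm f v)) (real_inner_le_norm f v)
      have h3 : α⁻¹ * ‖f‖ ^ 2 * B v v
          = α⁻¹ * ‖f‖ ^ 2 * E.bilin v v + ‖f‖ ^ 2 * ‖(v : H)‖ ^ 2 := by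
        rw [hB']; field_simp
      rw [h3]
      have h4 : 0 ≤ α⁻¹ * ‖f‖ ^ 2 * E.bilin v v := by positivity
      simp only [LinearMap.comp_apply, Submodule.subtype_apply, innerₗ_apply_apply]
      linarith)
  exact ⟨u, u.2, fun v => hu v⟩

end FormOn

/-- A densely defined closed quadratic form on `H`. -/
structure ClosedForm (H : Type*) [NormedAddCommGroup H] [InnerProductSpace ℝ H]
    extends FormOn H where
  dense : Dense (domain : Set H)
  closed : toFormOn.IsClosed

namespace ClosedForm

variable {H : Type*} [NormedAddCommGroup H] [InnerProductSpace ℝ H]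

/-- The resolvent operator `K_α`, for `α > 0`: `u = K_α f` is the unique element of the domain with
`𝓔(u, v) + α (u, v) = (f, v)` for all `v` in the domain. -/
def resolvent (E : ClosedForm H) (α : ℝ) (hα : 0 < α) : H →L[ℝ] H :=
  LinearMap.mkContinuous
    { toFun := fun f => (E.closed.exists_isResolventAt hα f).choose
      map_add' := fun f g =>
        (E.closed.exists_isResolventAt hα (f + g)).choose_spec.unique hα
          ((E.closed.exists_isResolventAt hα f).choose_spec.add
            (E.closed.exists_isResolventAt hα g).choose_spec)
      map_smul' := fun c f =>
        (E.closed.exists_isResolventAt hα (c • f)).choose_spec.unique hα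
          ((E.closed.exists_isResolventAt hα f).choose_spec.smul c) }
    α⁻¹ fun f => (E.closed.exists_isResolventAt hα f).choose_spec.norm_le hα

theorem resolvent_spec (E : ClosedForm H) (α : ℝ) (hα : 0 < α) (f : H) :
    E.toFormOn.IsResolventAt α f (E.resolvent α hα f) :=
  (E.closed.exists_isResolventAt hα f).choose_spec

/-- The bounded operator `β (β K_β - 1)`. -/
def yosida (E : ClosedForm H) (β : Set.Ioi (0 : ℝ)) : H →L[ℝ] H :=
  (β : ℝ) • ((β : ℝ) • E.resolvent β β.2 - 1)

/-- The semigroup of the form (generated by minus the nonnegative self-adjoint operator associated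
with it), as constructed in the Hille-Yosida theorem:
`T_t f = lim_{β → ∞} exp (t β (β K_β - 1)) f`. The limit exists for all `t ≥ 0` and `f`, see
`tendsto_semigroup`. -/
def semigroup (E : ClosedForm H) (t : ℝ) (f : H) : H :=
  limUnder atTop fun β : Set.Ioi (0 : ℝ) => NormedSpace.exp (t • E.yosida β) f

theorem resolvent_eq_of (E : ClosedForm H) {α : ℝ} (hα : 0 < α) {f u : H}
    (h : E.toFormOn.IsResolventAt α f u) : E.resolvent α hα f = u :=
  (E.resolvent_spec α hα f).unique hα h

theorem resolvent_identity (E : ClosedForm H) {α β : ℝ} (hα : 0 < α) (hβ : 0 < β) (f : H) :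
    E.resolvent α hα (f + (α - β) • E.resolvent β hβ f) = E.resolvent β hβ f := by
  refine E.resolvent_eq_of hα ?_
  obtain ⟨h, hu⟩ := E.resolvent_spec β hβ f
  refine ⟨h, fun v => ?_⟩
  rw [inner_add_left, real_inner_smul_left, ← hu v]
  ring

theorem resolvent_comm (E : ClosedForm H) {α β : ℝ} (hα : 0 < α) (hβ : 0 < β) :
    Commute (E.resolvent α hα) (E.resolvent β hβ) := by
  rcases eq_or_ne α β with rfl | hne
  · exact Commute.refl _
  · refine ContinuousLinearMap.ext fun f => ?_
    have h1 := E.resolvent_identity hα hβ f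
    have h2 := E.resolvent_identity hβ hα f
    rw [map_add, map_smul] at h1 h2
    have h3 : (α - β) • (E.resolvent α hα (E.resolvent β hβ f)
        - E.resolvent β hβ (E.resolvent α hα f)) = 0 := by
      have e : (β - α) = -(α - β) := by ring
      rw [e, neg_smul] at h2
      rw [smul_sub, sub_eq_zero]
      rw [← sub_eq_iff_eq_add'.2 h1.symm, ← neg_eq_iff_eq_neg.2 (sub_eq_iff_eq_add'.2 h2.symm)]
      abel
    exact sub_eq_zero.1 ((smul_eq_zero.1 h3).resolve_left (sub_ne_zero.2 hne))

theorem norm_resolvent_le (E : ClosedForm H) {α : ℝ} (hα : 0 < α) :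
    ‖E.resolvent α hα‖ ≤ α⁻¹ :=
  LinearMap.mkContinuous_norm_le _ (by positivity) _

theorem commute_yosida (E : ClosedForm H) (β γ : Set.Ioi (0 : ℝ)) :
    Commute (E.yosida β) (E.yosida γ) := by
  unfold yosida
  have h := E.resolvent_comm β.2 γ.2
  exact (((h.smul_left _).smul_right _).sub_left (Commute.one_left _)
    |>.sub_right ((Commute.one_right _))).smul_left _ |>.smul_right _

theorem tendsto_inv_mul (C : ℝ) :
    Tendsto (fun β : Set.Ioi (0 : ℝ) => (β : ℝ)⁻¹ * C) atTop (𝓝 0) := by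
  have h : Tendsto (fun β : Set.Ioi (0 : ℝ) => (β : ℝ)) atTop atTop :=
    tendsto_atTop_atTop.2 fun b => ⟨⟨max b 1, Set.mem_Ioi.2 (lt_max_of_lt_right one_pos)⟩,
      fun a ha => (le_max_left b 1).trans ha⟩
  simpa using (tendsto_inv_atTop_zero.comp h).mul_const C

theorem mul_resolvent_sub (E : ClosedForm H) (β : Set.Ioi (0 : ℝ)) (g : H) :
    (β : ℝ) • E.resolvent β β.2 (E.resolvent 1 one_pos g) - E.resolvent 1 one_pos g
      = - E.resolvent β β.2 (g - E.resolvent 1 one_pos g) := by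
  have h := E.resolvent_identity β.2 one_pos g
  rw [map_add, map_smul, sub_smul, one_smul] at h
  nth_rewrite 2 [← h]
  rw [map_sub]
  abel

theorem norm_mul_resolvent_le (E : ClosedForm H) (β : Set.Ioi (0 : ℝ)) (f : H) :
    ‖(β : ℝ) • E.resolvent β β.2 f‖ ≤ ‖f‖ := by
  have hβ : (0 : ℝ) < β := β.2
  rw [norm_smul, Real.norm_of_nonneg hβ.le]
  calc (β : ℝ) * ‖E.resolvent β β.2 f‖ ≤ β * ((β : ℝ)⁻¹ * ‖f‖) := by
        gcongr; exact (E.resolvent β β.2).le_of_opNorm_le (E.norm_resolvent_le β.2) f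
    _ = ‖f‖ := mul_inv_cancel_left₀ hβ.ne' _

theorem norm_exp_smul_le {A : H →L[ℝ] H} (hA : ‖A‖ ≤ 1) {s : ℝ} (hs : 0 ≤ s) :
    ‖NormedSpace.exp (s • A)‖ ≤ Real.exp s := by
  have h : HasSum (fun n : ℕ => s ^ n / n.factorial) (Real.exp s) := by
    rw [Real.exp_eq_exp_ℝ]
    exact NormedSpace.expSeries_div_hasSum_exp s
  rw [congrFun (NormedSpace.exp_eq_tsum ℝ) (s • A)]
  refine tsum_of_norm_bounded h fun n => ?_
  rw [norm_smul, div_eq_inv_mul, norm_inv, RCLike.norm_natCast]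
  gcongr
  rcases n.eq_zero_or_pos with rfl | hn
  · have h1 : ‖(1 : H →L[ℝ] H)‖ ≤ 1 := ContinuousLinearMap.norm_id_le
    simpa using h1
  · refine (norm_pow_le' _ hn).trans ?_
    gcongr
    rw [norm_smul, Real.norm_of_nonneg hs]
    exact mul_le_of_le_one_right hs hA

variable [CompleteSpace H]

theorem exp_add_of_comm {A B : H →L[ℝ] H} (h : Commute A B) :
    NormedSpace.exp (A + B) = NormedSpace.exp A * NormedSpace.exp B := by
  let _ : NormedAlgebra ℚ (H →L[ℝ] H) := NormedAlgebra.restrictScalars ℚ ℝ _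
  exact NormedSpace.exp_add_of_commute h

theorem norm_exp_yosida_le (E : ClosedForm H) {t : ℝ} (ht : 0 ≤ t) (β : Set.Ioi (0 : ℝ)) :
    ‖NormedSpace.exp (t • E.yosida β)‖ ≤ 1 := by
  have hβ : (0 : ℝ) < β := β.2
  have e : t • E.yosida β
      = (t * β) • ((β : ℝ) • E.resolvent β β.2) + algebraMap ℝ (H →L[ℝ] H) (-(t * β)) := by
    rw [yosida, Algebra.algebraMap_eq_smul_one, neg_smul, smul_smul, smul_sub, sub_eq_add_neg]
  have h1 : ‖(β : ℝ) • E.resolvent β β.2‖ ≤ 1 := by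
    rw [norm_smul, Real.norm_of_nonneg hβ.le]
    calc (β : ℝ) * ‖E.resolvent β β.2‖ ≤ β * (β : ℝ)⁻¹ := by
          gcongr; exact E.norm_resolvent_le β.2
      _ = 1 := mul_inv_cancel₀ hβ.ne'
  rw [e, exp_add_of_comm (Algebra.commute_algebraMap_right _ _), ← NormedSpace.algebraMap_exp_comm,
    ← Real.exp_eq_exp_ℝ, Algebra.algebraMap_eq_smul_one, mul_smul_comm, mul_one, norm_smul,
    Real.norm_of_nonneg (Real.exp_pos _).le, Real.exp_neg]
  rw [inv_mul_le_iff₀ (Real.exp_pos _), mul_one]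
  exact norm_exp_smul_le h1 (by positivity)

theorem norm_exp_yosida_sub_le (E : ClosedForm H) {t : ℝ} (ht : 0 ≤ t)
    (β γ : Set.Ioi (0 : ℝ)) (f : H) :
    ‖NormedSpace.exp (t • E.yosida β) f - NormedSpace.exp (t • E.yosida γ) f‖
      ≤ t * ‖E.yosida β f - E.yosida γ f‖ := by
  set A := t • E.yosida β with hA
  set B := t • E.yosida γ with hB
  have hAB : Commute A B := ((E.commute_yosida β γ).smul_left t).smul_right t
  let g : ℝ → H := fun s => (NormedSpace.exp (s • (A - B)) * NormedSpace.exp B) f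
  have hd : ∀ s : ℝ, HasDerivAt g
      ((NormedSpace.exp (s • (A - B)) * (A - B) * NormedSpace.exp B) f) s := fun s =>
    (((hasDerivAt_exp_smul_const (A - B) s).mul_const (NormedSpace.exp B)).clm_apply
      (hasDerivAt_const s f)).congr_deriv (by simp)
  have hbd : ∀ s ∈ Set.Ico (0 : ℝ) 1,
      ‖(NormedSpace.exp (s • (A - B)) * (A - B) * NormedSpace.exp B) f‖ ≤ ‖(A - B) f‖ := by
    intro s hs
    have hc : Commute (A - B) (NormedSpace.exp B) := by
      let _ : NormedAlgebra ℚ (H →L[ℝ] H) := NormedAlgebra.restrictScalars ℚ ℝ _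
      exact (hAB.sub_left (Commute.refl B)).exp_right
    have e : NormedSpace.exp (s • (A - B)) * (A - B) * NormedSpace.exp B
        = NormedSpace.exp ((s * t) • E.yosida β) * NormedSpace.exp (((1 - s) * t) • E.yosida γ)
          * (A - B) := by
      rw [mul_assoc, hc.eq, ← mul_assoc]
      congr 1
      rw [← exp_add_of_comm (((hAB.sub_left (Commute.refl B))).smul_left s),
        ← exp_add_of_comm (((E.commute_yosida β γ).smul_left _).smul_right _)]
      congr 1
      rw [hA, hB]
      module
    rw [e]
    have h1 := E.norm_exp_yosida_le (mul_nonneg hs.1 ht) β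
    have h2 := E.norm_exp_yosida_le (mul_nonneg (sub_nonneg.2 hs.2.le) ht) γ
    refine ((NormedSpace.exp ((s * t) • E.yosida β) *
      NormedSpace.exp (((1 - s) * t) • E.yosida γ)).le_opNorm ((A - B) f)).trans ?_
    refine mul_le_of_le_one_left (norm_nonneg _) ((norm_mul_le _ _).trans ?_)
    exact mul_le_one₀ h1 (norm_nonneg _) h2
  have h := norm_image_sub_le_of_norm_deriv_le_segment_01'
    (fun s _ => (hd s).hasDerivWithinAt) hbd
  have h1 : g 1 = NormedSpace.exp A f := by
    simp only [g]
    rw [← exp_add_of_comm (((hAB.sub_left (Commute.refl B))).smul_left 1), one_smul,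
      sub_add_cancel]
  have h0 : g 0 = NormedSpace.exp B f := by
    simp [g]
  rw [h1, h0] at h
  refine h.trans (le_of_eq ?_)
  rw [hA, hB, ← smul_sub, smul_apply, norm_smul, Real.norm_of_nonneg ht,
    sub_apply]

theorem dense_range_resolvent (E : ClosedForm H) :
    DenseRange (E.resolvent 1 one_pos) := by
  have hR : (LinearMap.range (E.resolvent 1 one_pos : H →ₗ[ℝ] H)).topologicalClosure = ⊤ := by
    rw [Submodule.topologicalClosure_eq_top_iff, Submodule.eq_bot_iff]
    intro h hh
    obtain ⟨hu, hv⟩ := E.resolvent_spec 1 one_pos h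
    set u := E.resolvent 1 one_pos h with hudef
    have h0 : ⟪h, u⟫ = 0 := by
      rw [real_inner_comm]
      exact (Submodule.mem_orthogonal _ _).1 hh u ⟨h, rfl⟩
    have h1 := hv ⟨u, hu⟩
    rw [h0, one_mul, real_inner_self_eq_norm_sq] at h1
    have h2 := E.nonneg ⟨u, hu⟩
    have h3 : ‖u‖ = 0 := by nlinarith [sq_nonneg ‖u‖]
    have h4 : (⟨u, hu⟩ : E.domain) = 0 := Subtype.ext (norm_eq_zero.1 h3)
    refine E.dense.eq_zero_of_inner_left (𝕜 := ℝ) fun v hv' => ?_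
    have h5 := hv ⟨v, hv'⟩
    have h6 : E.resolvent 1 one_pos h = 0 := norm_eq_zero.1 h3
    rw [h4, h6] at h5
    simpa using h5.symm
  intro x
  have := hR ▸ Submodule.mem_top (x := x)
  exact this

theorem tendsto_mul_resolvent (E : ClosedForm H) (f : H) :
    Tendsto (fun β : Set.Ioi (0 : ℝ) => (β : ℝ) • E.resolvent β β.2 f) atTop (𝓝 f) := by
  rw [Metric.tendsto_atTop]
  intro ε hε
  obtain ⟨g, hg⟩ := E.dense_range_resolvent.exists_dist_lt f (show (0 : ℝ) < ε / 3 by positivity)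
  set h := E.resolvent 1 one_pos g with hh
  obtain ⟨N, hN⟩ := Metric.tendsto_atTop.1 (tendsto_inv_mul ‖g - h‖) (ε / 3) (by positivity)
  refine ⟨N, fun β hβ => ?_⟩
  have h1 : ‖(β : ℝ) • E.resolvent β β.2 h - h‖ < ε / 3 := by
    rw [hh, E.mul_resolvent_sub, norm_neg]
    refine ((E.resolvent β β.2).le_of_opNorm_le (E.norm_resolvent_le β.2) _).trans_lt ?_
    have := hN β hβ
    rw [Real.dist_eq, sub_zero] at this
    exact (le_abs_self _).trans_lt this
  have h2 := E.norm_mul_resolvent_le β (f - h)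
  rw [dist_eq_norm] at hg ⊢
  have e : (β : ℝ) • E.resolvent β β.2 f - f
      = (β : ℝ) • E.resolvent β β.2 (f - h) + ((β : ℝ) • E.resolvent β β.2 h - h) - (f - h) := by
    rw [map_sub, smul_sub]; abel
  rw [e]
  have h3 := norm_sub_le ((β : ℝ) • E.resolvent β β.2 (f - h)
    + ((β : ℝ) • E.resolvent β β.2 h - h)) (f - h)
  have h4 := norm_add_le ((β : ℝ) • E.resolvent β β.2 (f - h))
    ((β : ℝ) • E.resolvent β β.2 h - h)
  linarith

theorem cauchySeq_exp_yosida (E : ClosedForm H) {t : ℝ} (ht : 0 ≤ t) (f : H) :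
    CauchySeq (fun β : Set.Ioi (0 : ℝ) => NormedSpace.exp (t • E.yosida β) f) := by
  rw [Metric.cauchySeq_iff]
  intro ε hε
  obtain ⟨g, hg⟩ := E.dense_range_resolvent.exists_dist_lt f (show (0 : ℝ) < ε / 4 by positivity)
  set h := E.resolvent 1 one_pos g with hh
  have hy : Tendsto (fun β : Set.Ioi (0 : ℝ) => t • E.yosida β h) atTop (𝓝 (t • -(g - h))) := by
    refine ((E.tendsto_mul_resolvent (g - h)).neg.const_smul t).congr fun β => ?_
    rw [← smul_neg]
    have := E.mul_resolvent_sub β g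
    rw [← hh] at this
    rw [yosida, smul_apply, sub_apply, smul_apply, one_apply_eq_self, this]
  obtain ⟨N, hN⟩ := Metric.cauchySeq_iff.1 hy.cauchySeq (ε / 4) (by positivity)
  refine ⟨N, fun β hβ γ hγ => ?_⟩
  have h1 := hN β hβ γ hγ
  rw [dist_eq_norm, ← smul_sub, norm_smul, Real.norm_of_nonneg ht] at h1
  have h2 := E.norm_exp_yosida_sub_le ht β γ h
  have h3 : ∀ δ : Set.Ioi (0 : ℝ), ‖NormedSpace.exp (t • E.yosida δ) (f - h)‖ < ε / 4 := fun δ =>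
    (((NormedSpace.exp (t • E.yosida δ)).le_of_opNorm_le (E.norm_exp_yosida_le ht δ) _).trans_eq
      (one_mul _)).trans_lt (by rwa [← dist_eq_norm])
  have e : NormedSpace.exp (t • E.yosida β) f - NormedSpace.exp (t • E.yosida γ) f
      = NormedSpace.exp (t • E.yosida β) (f - h) - NormedSpace.exp (t • E.yosida γ) (f - h)
        + (NormedSpace.exp (t • E.yosida β) h - NormedSpace.exp (t • E.yosida γ) h) := by
    rw [map_sub, map_sub]; abel
  rw [dist_eq_norm, e]
  have h4 := norm_add_le (NormedSpace.exp (t • E.yosida β) (f - h)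
    - NormedSpace.exp (t • E.yosida γ) (f - h))
    (NormedSpace.exp (t • E.yosida β) h - NormedSpace.exp (t • E.yosida γ) h)
  have h5 := norm_sub_le (NormedSpace.exp (t • E.yosida β) (f - h))
    (NormedSpace.exp (t • E.yosida γ) (f - h))
  have h6 := h3 β
  have h7 := h3 γ
  linarith

/-- The limit that defines the semigroup exists. -/
theorem tendsto_semigroup (E : ClosedForm H) {t : ℝ} (ht : 0 ≤ t) (f : H) :
    Tendsto (fun β : Set.Ioi (0 : ℝ) => NormedSpace.exp (t • E.yosida β) f) atTop
      (𝓝 (E.semigroup t f)) :=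
  (E.cauchySeq_exp_yosida ht f).tendsto_limUnder

end ClosedForm

/-! ## Dirichlet forms and invariant sets -/

variable {X : Type*} [MeasurableSpace X]

/-- The normal contraction `u ↦ min (max u 0) 1` on `L²`. -/
def unitContraction {m : Measure X} (u : Lp ℝ 2 m) : Lp ℝ 2 m :=
  LipschitzWith.compLp (g := fun x : ℝ => min (max x 0) 1) (c := 1)
    ((LipschitzWith.id.max_const 0).min_const 1) (by simp) u

/-- A (symmetric) Dirichlet form on `L²(X, m)`: a densely defined closed quadratic form with the
Markov property. -/
structure DirichletForm (m : Measure X) extends ClosedForm (Lp ℝ 2 m) where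
  markov : ∀ u ∈ domain, unitContraction u ∈ domain ∧
    toFormOn.energy (unitContraction u) ≤ toFormOn.energy u

/-- Multiplication `u ↦ 1_Y u` on `L²(X, m)`. -/
def mulIndicator {m : Measure X} {Y : Set X} (hY : MeasurableSet Y) (u : Lp ℝ 2 m) : Lp ℝ 2 m :=
  ((Lp.memLp u).indicator hY).toLp (Y.indicator u)

theorem indicator_ae_eq_of_restrict {m : Measure X} {Y : Set X} (hY : MeasurableSet Y)
    {f g : X → ℝ} (h : f =ᵐ[m.restrict Y] g) : Y.indicator f =ᵐ[m] Y.indicator g := by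
  filter_upwards [(ae_restrict_iff' hY).1 h] with x hx
  by_cases hxY : x ∈ Y
  · simp [hxY, hx hxY]
  · simp [hxY]

theorem coeFn_mulIndicator {m : Measure X} {Y : Set X} (hY : MeasurableSet Y) (u : Lp ℝ 2 m) :
    mulIndicator hY u =ᵐ[m] Y.indicator u :=
  MemLp.coeFn_toLp _

theorem memLp_indicator_of_restrict {m : Measure X} {Y : Set X} (hY : MeasurableSet Y)
    (w : Lp ℝ 2 (m.restrict Y)) : MemLp (Y.indicator w) 2 m :=
  (memLp_indicator_iff_restrict hY).2 (Lp.memLp w)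

/-- Extension by zero `L²(Y, m|_Y) → L²(X, m)`. -/
def extendByZero (m : Measure X) {Y : Set X} (hY : MeasurableSet Y) :
    Lp ℝ 2 (m.restrict Y) →ₗ[ℝ] Lp ℝ 2 m where
  toFun w := (memLp_indicator_of_restrict hY w).toLp (Y.indicator w)
  map_add' v w := by
    rw [← MemLp.toLp_add, MemLp.toLp_eq_toLp_iff, ← Set.indicator_add']
    exact indicator_ae_eq_of_restrict hY (Lp.coeFn_add v w)
  map_smul' c w := by
    rw [RingHom.id_apply, ← MemLp.toLp_const_smul, MemLp.toLp_eq_toLp_iff]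
    refine (indicator_ae_eq_of_restrict hY (Lp.coeFn_smul c w)).trans (Eq.eventuallyEq ?_)
    exact Set.indicator_const_smul Y c w

theorem coeFn_extendByZero {m : Measure X} {Y : Set X} (hY : MeasurableSet Y)
    (w : Lp ℝ 2 (m.restrict Y)) : extendByZero m hY w =ᵐ[m] Y.indicator w := by
  rw [extendByZero, LinearMap.coe_mk, AddHom.coe_mk]
  exact MemLp.coeFn_toLp _

namespace DirichletForm

variable {m : Measure X}

/-- The operator `T_t` of the semigroup of the form commutes with multiplication by `1_Y`. -/
def InvariantAt (E : DirichletForm m) (t : ℝ) {Y : Set X} (hY : MeasurableSet Y) : Prop :=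
  ∀ u : Lp ℝ 2 m, E.semigroup t (mulIndicator hY u) = mulIndicator hY (E.semigroup t u)

/-- The part `𝓔^Y` of `𝓔` on `Y`, a form on `L²(Y, m|_Y)`. Its domain consists of the restrictions
`u|_Y` of those `u` in the domain of `𝓔` with `1_Y u` in the domain (if `Y` is invariant, this is
every `u` in the domain), and `𝓔^Y[u|_Y] = 𝓔[1_Y u]`. It is written here in terms of the extension
by zero `1_Y u` of `w = u|_Y`. -/
def part (E : DirichletForm m) {Y : Set X} (hY : MeasurableSet Y) :
    FormOn (Lp ℝ 2 (m.restrict Y)) :=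
  E.toFormOn.comap (extendByZero m hY)

end DirichletForm

end

noncomputable section

/-! ## Uniqueness of the positive square root -/

section SquareRoot

variable {H : Type*} [NormedAddCommGroup H] [InnerProductSpace ℝ H]

/-! Let `P` be multiplication by `1_Y`, an orthogonal projection. Invariance of `Y` amounts to an
orthogonal splitting of the form (`FormOn.Reduces`): `P` preserves the domain and `𝓔(P u, u - P u) =
0`. This is equivalent to `𝓔[P u] + 𝓔[u - P u] ≤ 𝓔[u]` for all `u`, a condition that survives Mosco
limits: take a recovery sequence `u_k → v` for the right side, and note that `P u_k` and `u_k - P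
u_k` converge strongly, so the liminf bound applies to both terms on the left
(`MoscoConverges.reduces`). For (b), the liminf bound passes through the weakly continuous extension
by zero, and restricting a recovery sequence to `Y` does not raise its energy
(`MoscoConverges.comap`).

What remains is the passage between semigroup and form. From form to semigroup, `P` is symmetric for
`𝓔` as well as for the scalar product, so it commutes with each `K_α` and hence with every `T_t`.
From semigroup to form, commutation is given for a single `t` only. A positive contraction is
determined by its square, so commutation descends from `t` to all `t / 2 ^ n`; difference quotients
along these times give commutation with the generator in a weak sense, which yields commutation with
`K_1` (`ClosedForm.resolvent_comm_of_semigroup_comm`). Finally `K_1` is the adjoint of the embedding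
of the form domain, and this makes `P` an orthogonal projection of that domain
(`exists_lift_projection_of_complete`). -/

theorem norm_sq_le_inner_of_contraction {A : H →L[ℝ] H} (hs : ∀ x y, ⟪A x, y⟫ = ⟪x, A y⟫)
    (hp : ∀ x, 0 ≤ ⟪A x, x⟫) (hc : ∀ x, ‖A x‖ ≤ ‖x‖) (x : H) : ‖A x‖ ^ 2 ≤ ⟪A x, x⟫ := by
  -- Positivity at `x - A x` reads `2‖A x‖² ≤ ⟪A x, x⟫ + ⟪A (A x), A x⟫`, and contractivity bounds
  -- the last term by `‖A x‖²`.
  have h1 := hp (x - A x)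
  rw [map_sub, inner_sub_left, inner_sub_right, inner_sub_right, hs (A x) x,
    real_inner_self_eq_norm_sq] at h1
  have h2 := real_inner_le_norm (A (A x)) (A x)
  have h3 := mul_le_mul_of_nonneg_right (hc (A x)) (norm_nonneg (A x))
  linarith [sq ‖A x‖]

/-- A positive contraction is determined by its square. -/
theorem eq_of_sq_eq_sq_of_positive {A B : H →L[ℝ] H}
    (hAs : ∀ x y, ⟪A x, y⟫ = ⟪x, A y⟫) (hBs : ∀ x y, ⟪B x, y⟫ = ⟪x, B y⟫)
    (hA : ∀ x, 0 ≤ ⟪A x, x⟫) (hB : ∀ x, 0 ≤ ⟪B x, x⟫)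
    (hAc : ∀ x, ‖A x‖ ≤ ‖x‖) (hBc : ∀ x, ‖B x‖ ≤ ‖x‖)
    (h : ∀ x, A (A x) = B (B x)) : A = B := by
  set D := A - B with hD
  set C := A + B with hC
  have hDs : ∀ x y, ⟪D x, y⟫ = ⟪x, D y⟫ := fun x y => by
    simp only [hD, sub_apply, inner_sub_left, inner_sub_right, hAs, hBs]
  have hCp : ∀ x, 0 ≤ ⟪C x, x⟫ := fun x => by
    simp only [hC, add_apply, inner_add_left]
    exact add_nonneg (hA x) (hB x)
  have hCc : ∀ x, ‖C x‖ ≤ 2 * ‖x‖ := fun x => by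
    have h1 := norm_add_le (A x) (B x)
    have h2 := hAc x
    have h3 := hBc x
    rw [hC, add_apply]
    linarith
  -- Since `A² = B²`, both products reduce to the commutator of `A` and `B`, with opposite signs.
  have hanti : ∀ x, C (D x) = - D (C x) := fun x => by
    simp only [hC, hD, add_apply, sub_apply, map_sub,
      map_add, h]
    abel
  set d := ‖D‖ with hd
  by_contra hne
  have hdpos : 0 < d := norm_pos_iff.2 (sub_ne_zero.2 hne)
  -- A vector that nearly attains `‖D‖` is an approximate eigenvector of `D²` for `d²`, with error
  -- `y` below. Anticommutation gives `⟪C D² x, x⟫ = -⟪C D x, D x⟫ ≤ 0`, so `⟪C x, x⟫` is small; but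
  -- `⟪C x, x⟫` dominates `‖D x‖² / 2`. The inequality makes this quantitative.
  have key : ∀ x, ‖x‖ ≤ 1 → d ^ 2 * (‖D x‖ ^ 2) ^ 2 ≤ 16 * (d ^ 2 - ‖D x‖ ^ 2) := by
    intro x hx
    set q := ‖D x‖ ^ 2 with hq
    have hCD : ⟪C (D (D x)), x⟫ ≤ 0 := by
      rw [hanti, inner_neg_left, hDs]
      exact neg_nonpos.2 (hCp _)
    set y := d ^ 2 • x - D (D x) with hy
    have hDD : ‖D (D x)‖ ^ 2 ≤ d ^ 2 * q := by
      rw [hq, ← mul_pow]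
      gcongr
      exact D.le_opNorm _
    have hyn : ‖y‖ ^ 2 ≤ d ^ 2 * (d ^ 2 - q) := by
      have h1 : ‖y‖ ^ 2 = d ^ 4 * ‖x‖ ^ 2 - 2 * (d ^ 2 * q) + ‖D (D x)‖ ^ 2 := by
        rw [hy, norm_sub_sq_real, norm_smul, real_inner_smul_left, ← hDs,
          real_inner_self_eq_norm_sq, Real.norm_of_nonneg (sq_nonneg d)]
        ring
      have h2 : ‖x‖ ^ 2 ≤ 1 := pow_le_one₀ (norm_nonneg _) hx
      have h3 := mul_le_mul_of_nonneg_left h2 (show 0 ≤ d ^ 4 by positivity)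
      rw [h1]
      linarith
    have hCx : d ^ 2 * ⟪C x, x⟫ ≤ 2 * ‖y‖ := by
      have h1 : d ^ 2 * ⟪C x, x⟫ = ⟪C y, x⟫ + ⟪C (D (D x)), x⟫ := by
        rw [hy, map_sub, map_smul, inner_sub_left, real_inner_smul_left]
        ring
      have h2 := real_inner_le_norm (C y) x
      have h3 := mul_le_mul (hCc y) hx (norm_nonneg _) (by positivity)
      linarith
    have hqC : q ≤ 2 * ⟪C x, x⟫ := by
      have h1 := norm_sq_le_inner_of_contraction hAs hA hAc x
      have h2 := norm_sq_le_inner_of_contraction hBs hB hBc x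
      have h3 : q ≤ (‖A x‖ + ‖B x‖) ^ 2 := by
        rw [hq]
        gcongr
        exact norm_sub_le _ _
      have h4 : ⟪C x, x⟫ = ⟪A x, x⟫ + ⟪B x, x⟫ := by
        rw [hC, add_apply, inner_add_left]
      nlinarith [sq_nonneg (‖A x‖ - ‖B x‖)]
    have h1 : d ^ 2 * q ≤ 4 * ‖y‖ := by
      have := mul_le_mul_of_nonneg_left hqC (sq_nonneg d)
      linarith
    have h2 : (d ^ 2 * q) ^ 2 ≤ (4 * ‖y‖) ^ 2 := by
      gcongr
    have h3 : d ^ 2 * (d ^ 2 * q ^ 2) ≤ d ^ 2 * (16 * (d ^ 2 - q)) := by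
      nlinarith
    exact le_of_mul_le_mul_left h3 (by positivity)
  -- With `q = ‖D x‖²`, the bound `q > d² / 2` turns `key` into `d⁶ / 4 ≤ 16 (d² - q)`, which `q >
  -- d² - d⁶ / 64` contradicts.
  have hlt : Real.sqrt (max (d ^ 2 / 2) (d ^ 2 - d ^ 6 / 64)) < d := by
    rw [Real.sqrt_lt' hdpos]
    refine max_lt ?_ ?_
    · linarith [pow_pos hdpos 2]
    · linarith [pow_pos hdpos 6]
  obtain ⟨x, hx, hr⟩ := D.exists_lt_apply_of_lt_opNorm hlt
  have h1 := (Real.sqrt_lt' ((Real.sqrt_nonneg _).trans_lt hr)).1 hr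
  obtain ⟨h2, h3⟩ := max_lt_iff.1 h1
  have h4 := key x hx.le
  have h5 : (d ^ 2 / 2) ^ 2 ≤ (‖D x‖ ^ 2) ^ 2 := by gcongr
  have h6 := mul_le_mul_of_nonneg_left h5 (sq_nonneg d)
  nlinarith

/-- An orthogonal projection that commutes with the square of a positive contraction commutes with
the contraction. -/
theorem commute_projection_of_commute_sq {A P : H →L[ℝ] H}
    (hAs : ∀ x y, ⟪A x, y⟫ = ⟪x, A y⟫) (hA : ∀ x, 0 ≤ ⟪A x, x⟫) (hAc : ∀ x, ‖A x‖ ≤ ‖x‖)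
    (hPs : ∀ x y, ⟪P x, y⟫ = ⟪x, P y⟫) (hPP : ∀ x, P (P x) = P x)
    (h : ∀ x, A (A (P x)) = P (A (A x))) (x : H) : A (P x) = P (A x) := by
  -- The reflection `R` is a symmetric isometric involution, so `R A R` is again a positive
  -- contraction, with square `R A² R = A²`. Uniqueness of the root gives `R A R = A`.
  set R : H →L[ℝ] H := 1 - (2 : ℝ) • P with hR
  have hRa : ∀ x, R x = x - (2 : ℝ) • P x := fun x => rfl
  have hRR : ∀ x, R (R x) = x := fun x => by
    simp only [hRa, map_sub, map_smul, hPP]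
    module
  have hRs : ∀ x y, ⟪R x, y⟫ = ⟪x, R y⟫ := fun x y => by
    simp only [hRa, inner_sub_left, inner_sub_right, real_inner_smul_left, real_inner_smul_right,
      hPs]
  have hRn : ∀ x, ‖R x‖ = ‖x‖ := fun x => by
    rw [← sq_eq_sq₀ (norm_nonneg _) (norm_nonneg _), ← real_inner_self_eq_norm_sq, hRs, hRR,
      real_inner_self_eq_norm_sq]
  have hRA : ∀ x, A (A (R x)) = R (A (A x)) := fun x => by
    simp only [hRa, map_sub, map_smul, h]
  have he : A = R * A * R := by
    refine eq_of_sq_eq_sq_of_positive hAs (fun x y => ?_) hA (fun x => ?_) hAc (fun x => ?_)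
      (fun x => ?_)
    · change ⟪R (A (R x)), y⟫ = ⟪x, R (A (R y))⟫
      rw [hRs, hAs, hRs]
    · change 0 ≤ ⟪R (A (R x)), x⟫
      rw [hRs]
      exact hA _
    · change ‖R (A (R x))‖ ≤ ‖x‖
      rw [hRn]
      exact (hAc _).trans_eq (hRn x)
    · change A (A x) = R (A (R (R (A (R x)))))
      rw [hRR, hRA, hRR]
  have h1 : R (A x) = A (R x) := by
    have h2 := congrArg R (DFunLike.congr_fun he x)
    change R (A x) = R (R (A (R x))) at h2
    rwa [hRR] at h2
  simp only [hRa, map_sub, map_smul, sub_right_inj] at h1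
  exact (smul_right_injective H (two_ne_zero (α := ℝ)) h1).symm

end SquareRoot

/-! ## The semigroup of a closed form -/

namespace ClosedForm

variable {H : Type*} [NormedAddCommGroup H] [InnerProductSpace ℝ H]

theorem inner_resolvent (E : ClosedForm H) {α : ℝ} (hα : 0 < α) (f g : H) :
    ⟪E.resolvent α hα f, g⟫ = ⟪f, E.resolvent α hα g⟫ := by
  obtain ⟨hu, h1⟩ := E.resolvent_spec α hα f
  obtain ⟨hv, h2⟩ := E.resolvent_spec α hα g
  rw [← h1 ⟨_, hv⟩, real_inner_comm, ← h2 ⟨_, hu⟩, E.symm, real_inner_comm (E.resolvent α hα f)]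

theorem inner_yosida (E : ClosedForm H) (β : Set.Ioi (0 : ℝ)) (f g : H) :
    ⟪E.yosida β f, g⟫ = ⟪f, E.yosida β g⟫ := by
  simp only [yosida, smul_apply, sub_apply,
    one_apply_eq_self, real_inner_smul_left, real_inner_smul_right,
    inner_sub_left, inner_sub_right, E.inner_resolvent β.2]

/-- On the range of `K_1` the Yosida approximation is `β K_β` applied to the vector `K_1 g - g`,
which does not depend on `β`; so it stays bounded as `β → ∞`. -/
theorem yosida_resolvent_one (E : ClosedForm H) (β : Set.Ioi (0 : ℝ)) (g : H) :
    E.yosida β (E.resolvent 1 one_pos g)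
      = - ((β : ℝ) • E.resolvent β β.2 (g - E.resolvent 1 one_pos g)) := by
  rw [← smul_neg, ← E.mul_resolvent_sub]
  rfl

/-- The Yosida approximation commutes with `β K_β`, so on the range of `K_1²` its square is two
contractions `β K_β` applied to a fixed vector. The bound is uniform in `β`. -/
theorem norm_yosida_yosida_le (E : ClosedForm H) (β : Set.Ioi (0 : ℝ)) (g : H) :
    ‖E.yosida β (E.yosida β (E.resolvent 1 one_pos (E.resolvent 1 one_pos g)))‖
      ≤ ‖g - E.resolvent 1 one_pos g - E.resolvent 1 one_pos (g - E.resolvent 1 one_pos g)‖ := by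
  have hc : ∀ x, E.yosida β ((β : ℝ) • E.resolvent β β.2 x)
      = (β : ℝ) • E.resolvent β β.2 (E.yosida β x) := fun x => by
    simp only [yosida, smul_apply, sub_apply, one_apply_eq_self, map_smul, map_sub]
  rw [yosida_resolvent_one, ← map_sub, map_neg, hc, yosida_resolvent_one, norm_neg]
  refine (E.norm_mul_resolvent_le β _).trans ?_
  rw [norm_neg]
  exact E.norm_mul_resolvent_le β _

/-! ### Symmetry, semigroup law, positivity and generator of `T_t`. -/

variable [CompleteSpace H]

theorem inner_exp_yosida (E : ClosedForm H) (t : ℝ) (β : Set.Ioi (0 : ℝ)) (f g : H) :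
    ⟪NormedSpace.exp (t • E.yosida β) f, g⟫ = ⟪f, NormedSpace.exp (t • E.yosida β) g⟫ := by
  have h : IsSelfAdjoint (t • E.yosida β) :=
    ContinuousLinearMap.isSelfAdjoint_iff_isSymmetric.2 fun x y => by
      change ⟪t • E.yosida β x, y⟫ = ⟪x, t • E.yosida β y⟫
      rw [real_inner_smul_left, real_inner_smul_right, E.inner_yosida]
  have h2 : IsSelfAdjoint (NormedSpace.exp (t • E.yosida β)) := by
    let _ : NormedAlgebra ℚ (H →L[ℝ] H) := NormedAlgebra.restrictScalars ℚ ℝ _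
    exact h.exp
  exact ContinuousLinearMap.isSelfAdjoint_iff_isSymmetric.1 h2 f g

theorem norm_exp_yosida_apply_le (E : ClosedForm H) {t : ℝ} (ht : 0 ≤ t) (β : Set.Ioi (0 : ℝ))
    (f : H) : ‖NormedSpace.exp (t • E.yosida β) f‖ ≤ ‖f‖ :=
  ((NormedSpace.exp (t • E.yosida β)).le_of_opNorm_le (E.norm_exp_yosida_le ht β) f).trans_eq
    (one_mul _)

/-- The operator `T_t`, for `t ≥ 0`, as a bounded operator. -/
def semigroupCLM (E : ClosedForm H) (t : ℝ) (ht : 0 ≤ t) : H →L[ℝ] H :=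
  LinearMap.mkContinuous
    { toFun := E.semigroup t
      map_add' := fun f g => tendsto_nhds_unique (E.tendsto_semigroup ht (f + g)) <| by
        simpa only [map_add] using (E.tendsto_semigroup ht f).add (E.tendsto_semigroup ht g)
      map_smul' := fun c f => tendsto_nhds_unique (E.tendsto_semigroup ht (c • f)) <| by
        simpa only [map_smul, RingHom.id_apply] using (E.tendsto_semigroup ht f).const_smul c }
    1 fun f => by
      rw [one_mul]
      exact le_of_tendsto (E.tendsto_semigroup ht f).norm
        (Eventually.of_forall fun β => E.norm_exp_yosida_apply_le ht β f)

theorem semigroupCLM_apply (E : ClosedForm H) {t : ℝ} (ht : 0 ≤ t) (f : H) :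
    E.semigroupCLM t ht f = E.semigroup t f := rfl

theorem norm_semigroup_le (E : ClosedForm H) {t : ℝ} (ht : 0 ≤ t) (f : H) :
    ‖E.semigroup t f‖ ≤ ‖f‖ :=
  le_of_tendsto (E.tendsto_semigroup ht f).norm
    (Eventually.of_forall fun β => E.norm_exp_yosida_apply_le ht β f)

theorem inner_semigroup (E : ClosedForm H) {t : ℝ} (ht : 0 ≤ t) (f g : H) :
    ⟪E.semigroup t f, g⟫ = ⟪f, E.semigroup t g⟫ := by
  refine tendsto_nhds_unique ((E.tendsto_semigroup ht f).inner tendsto_const_nhds) ?_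
  simp only [E.inner_exp_yosida]
  exact tendsto_const_nhds.inner (E.tendsto_semigroup ht g)

theorem semigroup_add (E : ClosedForm H) {s t : ℝ} (hs : 0 ≤ s) (ht : 0 ≤ t) (f : H) :
    E.semigroup (s + t) f = E.semigroup s (E.semigroup t f) := by
  refine tendsto_nhds_unique (E.tendsto_semigroup (add_nonneg hs ht) f) ?_
  -- The outer operator varies with `β` too; its uniform contractivity absorbs the error of the
  -- inner limit.
  have h1 : Tendsto (fun β => NormedSpace.exp (s • E.yosida β)
      (NormedSpace.exp (t • E.yosida β) f - E.semigroup t f)) atTop (𝓝 0) :=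
    squeeze_zero_norm (fun β => E.norm_exp_yosida_apply_le hs β _)
      (tendsto_iff_norm_sub_tendsto_zero.1 (E.tendsto_semigroup ht f))
  have h2 := h1.add (E.tendsto_semigroup hs (E.semigroup t f))
  rw [zero_add] at h2
  refine h2.congr fun β => ?_
  rw [map_sub, sub_add_cancel, add_smul,
    exp_add_of_comm (((Commute.refl (E.yosida β)).smul_left s).smul_right t)]
  rfl

/-- `T_t` is the square of the symmetric operator `T_{t/2}`. -/
theorem inner_semigroup_self_nonneg (E : ClosedForm H) {t : ℝ} (ht : 0 ≤ t) (f : H) :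
    0 ≤ ⟪E.semigroup t f, f⟫ := by
  have h : E.semigroup t f = E.semigroup (t / 2) (E.semigroup (t / 2) f) := by
    rw [← E.semigroup_add (by positivity) (by positivity), add_halves]
  rw [h, E.inner_semigroup (by positivity)]
  exact real_inner_self_nonneg

/-- A second-order Taylor bound, from two uses of the mean value inequality. Contractivity of `exp
(s A)` keeps the constant free of `‖A‖`, which is what allows `A` to be a Yosida approximation with
`β → ∞`. -/
theorem norm_exp_sub_sub_le {A : H →L[ℝ] H}
    (hA : ∀ s : ℝ, 0 ≤ s → ‖NormedSpace.exp (s • A)‖ ≤ 1) (v : H) :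
    ‖NormedSpace.exp A v - v - A v‖ ≤ ‖A (A v)‖ := by
  have hd : ∀ (B : H →L[ℝ] H) (w : H) (s : ℝ), HasDerivAt (fun s : ℝ => NormedSpace.exp (s • B) w)
      (NormedSpace.exp (s • B) (B w)) s := fun B w s =>
    ((hasDerivAt_exp_smul_const B s).clm_apply (hasDerivAt_const s w)).congr_deriv (by simp)
  have h1 : ∀ s : ℝ, 0 ≤ s → s ≤ 1 → ‖NormedSpace.exp (s • A) (A v) - A v‖ ≤ ‖A (A v)‖ := by
    intro s hs hs1
    have h := norm_image_sub_le_of_norm_deriv_le_segment_01'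
      (f := fun r : ℝ => NormedSpace.exp (r • (s • A)) (A v)) (C := ‖A (A v)‖)
      (fun r _ => (hd (s • A) (A v) r).hasDerivWithinAt) (fun r hr => ?_)
    · simpa using h
    · rw [smul_smul]
      refine ((NormedSpace.exp ((r * s) • A)).le_of_opNorm_le (hA _ (mul_nonneg hr.1 hs)) _).trans ?_
      rw [one_mul, smul_apply, norm_smul, Real.norm_of_nonneg hs]
      exact mul_le_of_le_one_left (norm_nonneg _) hs1
  have h2 := norm_image_sub_le_of_norm_deriv_le_segment_01'
    (f := fun s : ℝ => NormedSpace.exp (s • A) v - s • A v) (C := ‖A (A v)‖)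
    (fun s _ => ((hd A v s).sub ((hasDerivAt_id s).smul_const (A v))).hasDerivWithinAt)
    (fun s hs => by simpa using h1 s hs.1 hs.2.le)
  have e : NormedSpace.exp A v - v - A v = NormedSpace.exp A v - A v - v := by abel
  rw [e]
  simpa using h2

/-- The generator on the range of `K_1 ^ 2`. -/
theorem norm_semigroup_sub_sub_le (E : ClosedForm H) (g : H) :
    ∃ C, ∀ t : ℝ, 0 ≤ t → ‖E.semigroup t (E.resolvent 1 one_pos (E.resolvent 1 one_pos g))
      - E.resolvent 1 one_pos (E.resolvent 1 one_pos g)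
      - t • (E.resolvent 1 one_pos (E.resolvent 1 one_pos g) - E.resolvent 1 one_pos g)‖
        ≤ t ^ 2 * C := by
  set v := E.resolvent 1 one_pos (E.resolvent 1 one_pos g) with hv
  refine ⟨‖g - E.resolvent 1 one_pos g - E.resolvent 1 one_pos (g - E.resolvent 1 one_pos g)‖,
    fun t ht => ?_⟩
  have hy : Tendsto (fun β => E.yosida β v) atTop (𝓝 (v - E.resolvent 1 one_pos g)) := by
    have h := (E.tendsto_mul_resolvent (E.resolvent 1 one_pos g - v)).neg
    rw [neg_sub] at h
    refine h.congr fun β => ?_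
    rw [hv, yosida_resolvent_one]
  refine le_of_tendsto (((E.tendsto_semigroup ht v).sub tendsto_const_nhds).sub
    (hy.const_smul t)).norm (Eventually.of_forall fun β => ?_)
  have h := norm_exp_sub_sub_le (A := t • E.yosida β) (fun s hs => by
    rw [smul_smul]
    exact E.norm_exp_yosida_le (mul_nonneg hs ht) β) v
  simp only [smul_apply, map_smul] at h
  refine h.trans ?_
  rw [smul_smul, ← sq, norm_smul, Real.norm_of_nonneg (sq_nonneg t)]
  exact mul_le_mul_of_nonneg_left (E.norm_yosida_yosida_le β g) (sq_nonneg t)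

/-- The remainder is of order `t²`. The limit is the generator at `K_1² g`, since the generator
sends `K_1 f` to `K_1 f - f`. -/
theorem tendsto_generator (E : ClosedForm H) (g : H) :
    Tendsto (fun t : ℝ => t⁻¹ • (E.semigroup t (E.resolvent 1 one_pos (E.resolvent 1 one_pos g))
      - E.resolvent 1 one_pos (E.resolvent 1 one_pos g))) (𝓝[>] 0)
      (𝓝 (E.resolvent 1 one_pos (E.resolvent 1 one_pos g) - E.resolvent 1 one_pos g)) := by
  obtain ⟨C, hC⟩ := E.norm_semigroup_sub_sub_le g
  rw [tendsto_iff_norm_sub_tendsto_zero]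
  have h0 : Tendsto (fun t : ℝ => t * C) (𝓝[>] 0) (𝓝 0) := by
    have h := (tendsto_id (α := ℝ) (x := 𝓝 0)).mul_const C
    rw [zero_mul] at h
    exact h.mono_left nhdsWithin_le_nhds
  refine squeeze_zero' (Eventually.of_forall fun t => norm_nonneg _) ?_ h0
  filter_upwards [self_mem_nhdsWithin] with t ht
  have ht' : (0 : ℝ) < t := ht
  have h := hC t ht'.le
  refine le_of_mul_le_mul_left ?_ ht'
  calc t * _ = _ := by
        rw [← Real.norm_of_nonneg ht'.le, ← norm_smul, smul_sub, Real.norm_of_nonneg ht'.le,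
          smul_inv_smul₀ ht'.ne']
    _ ≤ _ := h
    _ = t * (t * C) := by ring

/-- An orthogonal projection that commutes with `T_t` for one `t > 0` commutes with `K_1`. -/
theorem resolvent_comm_of_semigroup_comm (E : ClosedForm H) {P : H →L[ℝ] H}
    (hPs : ∀ x y, ⟪P x, y⟫ = ⟪x, P y⟫) (hPP : ∀ x, P (P x) = P x) {t : ℝ} (ht : 0 < t)
    (h : ∀ u, E.semigroup t (P u) = P (E.semigroup t u)) (u : H) :
    E.resolvent 1 one_pos (P u) = P (E.resolvent 1 one_pos u) := by
  have hpos : ∀ n : ℕ, 0 < t / 2 ^ n := fun n => by positivity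
  -- Halving the time takes a positive square root, and commutation with `P` passes to the root.
  have hdyadic : ∀ (n : ℕ) (u : H),
      E.semigroup (t / 2 ^ n) (P u) = P (E.semigroup (t / 2 ^ n) u) := by
    intro n
    induction n with
    | zero => simpa using h
    | succ n ih =>
      have e : t / 2 ^ n = t / 2 ^ (n + 1) + t / 2 ^ (n + 1) := by
        rw [pow_succ]; field_simp; norm_num
      have hp := (hpos (n + 1)).le
      refine commute_projection_of_commute_sq (A := E.semigroupCLM _ hp)
        (E.inner_semigroup hp) (E.inner_semigroup_self_nonneg hp) (E.norm_semigroup_le hp)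
        hPs hPP fun x => ?_
      simp only [semigroupCLM_apply, ← E.semigroup_add hp hp, ← e]
      exact ih x
  have hlim : Tendsto (fun n : ℕ => t / 2 ^ n) atTop (𝓝[>] 0) :=
    tendsto_nhdsWithin_iff.2 ⟨tendsto_const_nhds.div_atTop
      (tendsto_pow_atTop_atTop_of_one_lt one_lt_two), Eventually.of_forall hpos⟩
  set K := E.resolvent 1 one_pos with hK
  have hKs : ∀ x y, ⟪K x, y⟫ = ⟪x, K y⟫ := E.inner_resolvent one_pos
  -- With `L` the generator, this is `⟪P L u, v⟫ = ⟪P u, L v⟫` for `u = K² f` and `v = K² g`: the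
  -- difference quotients at `t / 2 ^ n` are symmetric and commute with `P`.
  have key : ∀ f g, ⟪P (K (K f) - K f), K (K g)⟫ = ⟪P (K (K f)), K (K g) - K g⟫ := by
    intro f g
    refine tendsto_nhds_unique
      ((((P.continuous.tendsto _).comp ((E.tendsto_generator f).comp hlim))).inner
        tendsto_const_nhds) ?_
    refine (tendsto_const_nhds.inner ((E.tendsto_generator g).comp hlim)).congr fun n => ?_
    simp only [Function.comp_apply, ← hK, map_smul, map_sub, real_inner_smul_left,
      real_inner_smul_right, inner_sub_left, inner_sub_right, ← hdyadic, E.inner_semigroup (hpos n).le]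
  -- The terms `⟪P K² f, K² g⟫` on the two sides of `key` cancel. Density of the range of `K` then
  -- removes first the test vector `K g`, later the argument `K f`.
  have key2 : ∀ f g, ⟪K (P (K f)) - P (K (K f)), K g⟫ = 0 := by
    intro f g
    have h1 := key f g
    rw [map_sub, inner_sub_left, inner_sub_right, sub_right_inj] at h1
    rw [inner_sub_left, hKs, h1, sub_self]
  have hdense : DenseRange K := E.dense_range_resolvent
  have key3 : ∀ f, K (P (K f)) = P (K (K f)) := fun f =>
    sub_eq_zero.1 (hdense.eq_zero_of_inner_left (𝕜 := ℝ) (key2 f))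
  exact congrFun (hdense.equalizer (K.continuous.comp P.continuous)
    (P.continuous.comp K.continuous) (funext key3)) u

end ClosedForm

/-! ## Forms reduced by a projection -/

/-- A projection that commutes with `J ∘ k`, where `J` is an embedding of a space `V`, complete for
the scalar product `B`, into a Hilbert space and `k` is the adjoint of `J`, lifts to a `B`-orthogonal
projection on `V`. -/
theorem exists_lift_projection_of_complete {V H : Type*} [AddCommGroup V] [Module ℝ V]
    [NormedAddCommGroup H] [InnerProductSpace ℝ H]
    (B : V →ₗ[ℝ] V →ₗ[ℝ] ℝ) (hsymm : ∀ u v, B u v = B v u)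
    (hcomplete : ∀ u : ℕ → V,
      (∀ ε > 0, ∃ N, ∀ i ≥ N, ∀ j ≥ N, B (u i - u j) (u i - u j) < ε) →
      ∃ w, Tendsto (fun i => B (u i - w) (u i - w)) atTop (𝓝 0))
    (J : V →ₗ[ℝ] H) (hJ : ∀ v, ‖J v‖ ^ 2 ≤ B v v) (hinj : Function.Injective J)
    (k : H →ₗ[ℝ] V) (hk : ∀ f v, B (k f) v = ⟪f, J v⟫)
    (P : H →L[ℝ] H) (hPs : ∀ x y, ⟪P x, y⟫ = ⟪x, P y⟫) (hPP : ∀ x, P (P x) = P x)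
    (hPk : ∀ f, J (k (P f)) = P (J (k f))) (u : V) :
    ∃ w, J w = P (J u) ∧ B w (u - w) = 0 := by
  let c : InnerProductSpace.Core ℝ V :=
    { inner := fun u v => B u v
      conj_inner_symm := fun u v => by simpa using hsymm v u
      re_inner_nonneg := fun u => by simpa using (sq_nonneg _).trans (hJ u)
      add_left := fun u v w => by simp
      smul_left := fun u v r => by simp
      definite := fun u h => by
        have h1 := hJ u
        rw [show B u u = 0 from h] at h1
        have h2 : ‖J u‖ = 0 := pow_eq_zero_iff two_ne_zero |>.1 (le_antisymm h1 (sq_nonneg _))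
        exact hinj (by rw [map_zero, norm_eq_zero.1 h2]) }
  let _ : NormedAddCommGroup V := c.toNormedAddCommGroup
  let _ : InnerProductSpace ℝ V := InnerProductSpace.ofCore c.toCore
  have hin : ∀ u v : V, ⟪u, v⟫ = B u v := fun _ _ => rfl
  have hnorm : ∀ u : V, B u u = ‖u‖ ^ 2 := fun u => by
    rw [← hin, real_inner_self_eq_norm_sq]
  have : CompleteSpace V := by
    refine Metric.complete_of_cauchySeq_tendsto fun u hu => ?_
    obtain ⟨w, hw⟩ := hcomplete u (by
      intro ε hε
      obtain ⟨N, hN⟩ := Metric.cauchySeq_iff.1 hu (Real.sqrt ε) (Real.sqrt_pos.2 hε)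
      refine ⟨N, fun i hi j hj => ?_⟩
      have := hN i hi j hj
      rw [dist_eq_norm] at this
      rw [hnorm]
      exact (Real.lt_sqrt (norm_nonneg _)).1 this)
    refine ⟨w, tendsto_iff_norm_sub_tendsto_zero.2 ?_⟩
    have h2 := (Real.continuous_sqrt.tendsto 0).comp hw
    simp only [Real.sqrt_zero] at h2
    refine h2.congr fun i => ?_
    rw [Function.comp_apply, hnorm, Real.sqrt_sq (norm_nonneg _)]
  have hJc : Continuous J := (J.mkContinuous 1 fun v => by
    rw [one_mul, ← sq_le_sq₀ (norm_nonneg _) (norm_nonneg _), ← hnorm]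
    exact hJ v).continuous
  -- If `v` is `B`-orthogonal to the range of `k`, testing with `k (J v)` gives `‖J v‖² = 0`.
  have hdense : (LinearMap.range k).topologicalClosure = ⊤ := by
    rw [Submodule.topologicalClosure_eq_top_iff, Submodule.eq_bot_iff]
    intro v hv
    have h1 : ⟪J v, J v⟫ = 0 := by
      rw [← hk, ← hin]
      exact (Submodule.mem_orthogonal _ _).1 hv _ ⟨_, rfl⟩
    exact hinj (by rw [map_zero, inner_self_eq_zero.1 h1])
  have hu : u ∈ closure (Set.range k) := by
    have : u ∈ (LinearMap.range k).topologicalClosure := hdense ▸ Submodule.mem_top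
    exact this
  obtain ⟨x, hx, hxu⟩ := mem_closure_iff_seq_limit.1 hu
  choose f hf using hx
  obtain rfl : (fun n => k (f n)) = x := funext hf
  -- On the range of `k` the lifted projection is `k g ↦ k (P g)`. It is orthogonal, hence
  -- norm-decreasing, and so extends to the closure, which is all of `V`.
  have horth : ∀ g, ⟪k (P g), k g - k (P g)⟫ = 0 := fun g => by
    rw [hin, hk, map_sub, hPk, hPs, map_sub, hPP, sub_self, inner_zero_right]
  have hle : ∀ g, ‖k (P g)‖ ≤ ‖k g‖ := fun g => by
    have h1 := norm_add_sq_real (k (P g)) (k g - k (P g))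
    rw [horth, add_sub_cancel] at h1
    rw [← sq_le_sq₀ (norm_nonneg _) (norm_nonneg _)]
    nlinarith [sq_nonneg ‖k g - k (P g)‖]
  have hcauchy : CauchySeq fun n => k (P (f n)) := by
    refine Metric.cauchySeq_iff.2 fun ε hε => ?_
    obtain ⟨N, hN⟩ := Metric.cauchySeq_iff.1 hxu.cauchySeq ε hε
    refine ⟨N, fun i hi j hj => lt_of_le_of_lt ?_ (hN i hi j hj)⟩
    rw [dist_eq_norm, dist_eq_norm, ← map_sub, ← map_sub, ← map_sub]
    exact hle _
  obtain ⟨w, hw⟩ := cauchySeq_tendsto_of_complete hcauchy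
  refine ⟨w, ?_, ?_⟩
  · refine tendsto_nhds_unique ((hJc.tendsto w).comp hw) ?_
    refine (((P.continuous.comp hJc).tendsto u).comp hxu).congr fun n => ?_
    simp only [Function.comp_apply, hPk]
  · rw [← hin]
    refine tendsto_nhds_unique (hw.inner (hxu.sub hw)) ?_
    simp only [horth]
    exact tendsto_const_nhds

namespace FormOn

variable {H : Type*} [NormedAddCommGroup H] [InnerProductSpace ℝ H]

/-- The form splits orthogonally along the projection `P`: `P` maps the domain to itself and
`𝓔(P u, u - P u) = 0`. -/
def Reduces (E : FormOn H) (P : H →L[ℝ] H) : Prop :=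
  ∀ u : E.domain, ∃ w : E.domain, (w : H) = P u ∧ E.bilin w (u - w) = 0

theorem energy_of_mem (E : FormOn H) (u : E.domain) :
    E.energy u = ENNReal.ofReal (E.bilin u u) := by
  rw [energy, dif_pos u.2]

theorem mem_domain_of_energy_ne_top {E : FormOn H} {u : H} (h : E.energy u ≠ ⊤) :
    u ∈ E.domain := by
  by_contra hu
  exact h (by rw [energy, dif_neg hu])

theorem energy_comap {K : Type*} [NormedAddCommGroup K] [InnerProductSpace ℝ K]
    (E : FormOn H) (j : K →ₗ[ℝ] H) (w : K) : (E.comap j).energy w = E.energy (j w) := by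
  by_cases h : j w ∈ E.domain
  · rw [E.energy_of_mem ⟨j w, h⟩, (E.comap j).energy_of_mem ⟨w, h⟩]
    rfl
  · rw [energy, energy, dif_neg h]
    exact dif_neg h

theorem bilin_add_self {E : FormOn H} (u v : E.domain) :
    E.bilin (u + v) (u + v) = E.bilin u u + 2 * E.bilin u v + E.bilin v v := by
  simp only [map_add, LinearMap.add_apply, E.symm v u]
  ring

/-- Pythagoras for the orthogonal splitting; off the domain the right side is `⊤`. The inequality is
the form of the splitting that passes to Mosco limits. -/
theorem Reduces.energy_add_le {E : FormOn H} {P : H →L[ℝ] H} (h : E.Reduces P) (u : H) :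
    E.energy (P u) + E.energy (u - P u) ≤ E.energy u := by
  by_cases hu : u ∈ E.domain
  · obtain ⟨w, hw, h0⟩ := h ⟨u, hu⟩
    have h1 : u - P u = ((⟨u, hu⟩ - w : E.domain) : H) := by
      rw [← hw]
      rfl
    rw [h1, ← hw, energy_of_mem, energy_of_mem, E.energy_of_mem ⟨u, hu⟩,
      ← ENNReal.ofReal_add (E.nonneg _) (E.nonneg _)]
    have h2 := bilin_add_self w (⟨u, hu⟩ - w)
    rw [add_sub_cancel, h0] at h2
    exact ENNReal.ofReal_le_ofReal (by linarith)
  · rw [energy, energy, energy, dif_neg hu]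
    exact le_top

theorem Reduces.energy_le {E : FormOn H} {P : H →L[ℝ] H} (h : E.Reduces P) (u : H) :
    E.energy (P u) ≤ E.energy u :=
  le_self_add.trans (h.energy_add_le u)

/-- The inequality only says `𝓔(P u, u - P u) ≥ 0`. Applied to the reflected vector `P u - (u - P
u)`, it gives the opposite sign. -/
theorem reduces_of_energy_add_le {E : FormOn H} {P : H →L[ℝ] H} (hPP : ∀ x, P (P x) = P x)
    (h : ∀ u, E.energy (P u) + E.energy (u - P u) ≤ E.energy u) : E.Reduces P := by
  have hle : ∀ u : E.domain, ∃ w : E.domain, (w : H) = P u ∧ 0 ≤ E.bilin w (u - w) := by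
    intro u
    have h1 := h u
    rw [energy_of_mem] at h1
    have h2 : P u ∈ E.domain := mem_domain_of_energy_ne_top
      (ne_top_of_le_ne_top ENNReal.ofReal_ne_top (le_self_add.trans h1))
    refine ⟨⟨P u, h2⟩, rfl, ?_⟩
    set w : E.domain := ⟨P u, h2⟩ with hw
    have h3 : (u : H) - P u = ((u - w : E.domain) : H) := rfl
    have h4 : P u = (w : H) := rfl
    rw [h3, h4, energy_of_mem, energy_of_mem, ← ENNReal.ofReal_add (E.nonneg _) (E.nonneg _),
      ENNReal.ofReal_le_ofReal_iff (E.nonneg _)] at h1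
    have h5 := bilin_add_self w (u - w)
    rw [add_sub_cancel] at h5
    linarith
  intro u
  obtain ⟨w, hw, h1⟩ := hle u
  obtain ⟨w', hw', h2⟩ := hle (w - (u - w))
  have h3 : w' = w := Subtype.ext (by
    rw [hw', Submodule.coe_sub, Submodule.coe_sub, map_sub, map_sub, hw, hPP, sub_self, sub_zero])
  refine ⟨w, hw, le_antisymm ?_ h1⟩
  rw [h3, sub_sub_cancel_left, map_neg] at h2
  linarith

/-- `P` is symmetric for `𝓔`: both sides equal `𝓔(P u, P v)`. -/
theorem Reduces.exists_bilin_eq {E : FormOn H} {P : H →L[ℝ] H} (hPP : ∀ x, P (P x) = P x)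
    (h : E.Reduces P) (u v : E.domain) :
    ∃ u' v' : E.domain, (u' : H) = P u ∧ (v' : H) = P v ∧ E.bilin u' v = E.bilin u v' := by
  obtain ⟨u', hu, -⟩ := h u
  obtain ⟨v', hv, -⟩ := h v
  have key : ∀ x y x' y' : E.domain, (x' : H) = P x → (y' : H) = P y →
      E.bilin x' (y - y') = 0 := by
    intro x y x' y' hx hy
    -- The vector `P x + (y - P y)` has `P`-part `P x` and complementary part `y - P y`, so the
    -- diagonal condition polarizes.
    obtain ⟨w, hw, h0⟩ := h (x' + (y - y'))
    have h1 : w = x' := Subtype.ext (by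
      rw [hw, Submodule.coe_add, Submodule.coe_sub, map_add, map_sub, hx, hy, hPP, hPP, sub_self,
        add_zero])
    rwa [h1, add_sub_cancel_left] at h0
  refine ⟨u', v', hu, hv, ?_⟩
  have h1 := key u v u' v' hu hv
  have h2 := key v u v' u' hv hu
  rw [map_sub, sub_eq_zero] at h1 h2
  rw [h1, E.symm u' v', E.symm u v', h2]

end FormOn

namespace ClosedForm

variable {H : Type*} [NormedAddCommGroup H] [InnerProductSpace ℝ H]

/-- A closed form is reduced by every orthogonal projection that commutes with `K_1`. -/
theorem reduces_of_resolvent_comm (E : ClosedForm H) {P : H →L[ℝ] H}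
    (hPs : ∀ x y, ⟪P x, y⟫ = ⟪x, P y⟫) (hPP : ∀ x, P (P x) = P x)
    (h : ∀ u, E.resolvent 1 one_pos (P u) = P (E.resolvent 1 one_pos u)) :
    E.toFormOn.Reduces P := by
  intro u
  let B : E.domain →ₗ[ℝ] E.domain →ₗ[ℝ] ℝ :=
    E.bilin + (innerₗ H).compl₁₂ E.domain.subtype E.domain.subtype
  have hB : ∀ u v, B u v = E.bilin u v + ⟪(u : H), (v : H)⟫ := fun _ _ => rfl
  have hB' : ∀ u, B u u = E.bilin u u + ‖(u : H)‖ ^ 2 := fun u => by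
    rw [hB, real_inner_self_eq_norm_sq]
  obtain ⟨w, hw, h0⟩ := exists_lift_projection_of_complete B
    (fun u v => by rw [hB, hB, E.symm, real_inner_comm])
    (fun u hu => by
      obtain ⟨w, hw⟩ := E.closed u fun ε hε => by
        obtain ⟨N, hN⟩ := hu ε hε
        exact ⟨N, fun i hi j hj => by simpa only [hB', Submodule.coe_sub] using hN i hi j hj⟩
      exact ⟨w, by simpa only [hB', Submodule.coe_sub] using hw⟩)
    E.domain.subtype
    (fun v => by
      rw [hB']
      exact le_add_of_nonneg_left (E.nonneg v))
    Subtype.val_injective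
    ((E.resolvent 1 one_pos : H →ₗ[ℝ] H).codRestrict E.domain
      fun f => (E.resolvent_spec 1 one_pos f).fst)
    (fun f v => by
      obtain ⟨h1, h2⟩ := E.resolvent_spec 1 one_pos f
      rw [Submodule.subtype_apply, ← h2 v, one_mul]
      rfl)
    P hPs hPP h u
  refine ⟨w, hw, ?_⟩
  have hPw : P (w : H) = P u := by rw [show (w : H) = P u from hw, hPP]
  rw [hB, show (w : H) = P u from hw, hPs, Submodule.coe_sub, map_sub P, hPw, sub_self,
    inner_zero_right, add_zero] at h0
  exact h0

/-- Moving `P` onto the test vector, in `𝓔` and in the scalar product, shows that `P K_α f` solves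
the equation defining `K_α (P f)`. -/
theorem resolvent_comm_of_reduces (E : ClosedForm H) {P : H →L[ℝ] H}
    (hPs : ∀ x y, ⟪P x, y⟫ = ⟪x, P y⟫) (hPP : ∀ x, P (P x) = P x)
    (h : E.toFormOn.Reduces P) {α : ℝ} (hα : 0 < α) (f : H) :
    E.resolvent α hα (P f) = P (E.resolvent α hα f) := by
  refine E.resolvent_eq_of hα ?_
  obtain ⟨hu, hs⟩ := E.resolvent_spec α hα f
  obtain ⟨w, hw, -⟩ := h ⟨_, hu⟩
  have hw' : (w : H) = P (E.resolvent α hα f) := hw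
  rw [← hw']
  refine ⟨w.2, fun v => ?_⟩
  obtain ⟨u', v', hu', hv', he⟩ := h.exists_bilin_eq hPP ⟨_, hu⟩ v
  obtain rfl : u' = w := Subtype.ext (hu'.trans hw.symm)
  have h1 : ⟪(u' : H), (v : H)⟫ = ⟪E.resolvent α hα f, (v' : H)⟫ := by rw [hw', hPs, hv']
  rw [h1, hPs, ← hv', ← hs v', ← he]

theorem semigroup_comm_of_reduces [CompleteSpace H] (E : ClosedForm H) {P : H →L[ℝ] H}
    (hPs : ∀ x y, ⟪P x, y⟫ = ⟪x, P y⟫) (hPP : ∀ x, P (P x) = P x)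
    (h : E.toFormOn.Reduces P) {t : ℝ} (ht : 0 ≤ t) (u : H) :
    E.semigroup t (P u) = P (E.semigroup t u) := by
  refine tendsto_nhds_unique (E.tendsto_semigroup ht (P u)) ?_
  refine ((P.continuous.tendsto _).comp (E.tendsto_semigroup ht u)).congr fun β => ?_
  have h1 : Commute P (t • E.yosida β) := by
    refine ContinuousLinearMap.ext fun x => ?_
    simp only [yosida, mul_apply_eq_comp, smul_apply, sub_apply,
      one_apply_eq_self, map_smul, map_sub, E.resolvent_comm_of_reduces hPs hPP h β.2]
  have h2 : Commute P (NormedSpace.exp (t • E.yosida β)) := by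
    let _ : NormedAlgebra ℚ (H →L[ℝ] H) := NormedAlgebra.restrictScalars ℚ ℝ _
    exact h1.exp_right
  exact DFunLike.congr_fun h2.eq u

end ClosedForm

/-! ## Mosco convergence of reduced forms -/

theorem liminf_add_liminf_le (a b : ℕ → ℝ≥0∞) :
    liminf a atTop + liminf b atTop ≤ liminf (fun k => a k + b k) atTop := by
  have hmono : ∀ c : ℕ → ℝ≥0∞, Monotone fun n => ⨅ i ≥ n, c i := fun c _ _ hnm =>
    biInf_mono fun _ hi => hnm.trans hi
  simp only [liminf_eq_iSup_iInf_of_nat]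
  rw [ENNReal.iSup_add_iSup_of_monotone (hmono a) (hmono b)]
  exact iSup_mono fun n => le_iInf₂ fun i hi =>
    add_le_add (iInf₂_le i hi) (iInf₂_le i hi)

namespace MoscoConverges

variable {H K : Type*} [NormedAddCommGroup H] [InnerProductSpace ℝ H]
  [NormedAddCommGroup K] [InnerProductSpace ℝ K] {E : ℕ → FormOn H} {Einf : FormOn H}

theorem energy_le_liminf (hE : MoscoConverges E Einf) {u : ℕ → H} {v : H}
    (h : Tendsto u atTop (𝓝 v)) :
    Einf.energy v ≤ liminf (fun k => (E k).energy (u k)) atTop :=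
  hE.liminf_ge u v (((toWeakSpaceCLM ℝ H).continuous.tendsto v).comp h)

/-- A projection that reduces all forms of a sequence reduces the Mosco limit. -/
theorem reduces (hE : MoscoConverges E Einf) {P : H →L[ℝ] H} (hPP : ∀ x, P (P x) = P x)
    (h : ∀ k, (E k).Reduces P) : Einf.Reduces P := by
  refine FormOn.reduces_of_energy_add_le hPP fun v => ?_
  obtain ⟨u, hu, hle⟩ := hE.limsup_le v
  have hPu := (P.continuous.tendsto v).comp hu
  calc Einf.energy (P v) + Einf.energy (v - P v)
      ≤ liminf (fun k => (E k).energy (P (u k))) atTop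
        + liminf (fun k => (E k).energy (u k - P (u k))) atTop :=
        add_le_add (hE.energy_le_liminf hPu) (hE.energy_le_liminf (hu.sub hPu))
    _ ≤ liminf (fun k => (E k).energy (P (u k)) + (E k).energy (u k - P (u k))) atTop :=
        liminf_add_liminf_le _ _
    _ ≤ liminf (fun k => (E k).energy (u k)) atTop :=
        liminf_le_liminf (Eventually.of_forall fun k => (h k).energy_add_le (u k))
    _ ≤ limsup (fun k => (E k).energy (u k)) atTop := liminf_le_limsup
    _ ≤ Einf.energy v := hle

/-- Mosco convergence of the pull-backs along an embedding `j` whose range is the range of a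
projection `j ∘ r` that reduces the forms. -/
theorem comap (hE : MoscoConverges E Einf) (j : K →L[ℝ] H) (r : H →L[ℝ] K)
    (hr : ∀ w, r (j w) = w) (h : ∀ k, (E k).Reduces (j ∘L r)) :
    MoscoConverges (fun k => (E k).comap (j : K →ₗ[ℝ] H)) (Einf.comap (j : K →ₗ[ℝ] H)) where
  liminf_ge w v hw := by
    simp only [FormOn.energy_comap]
    -- A bounded operator is weakly continuous, so `j` carries weak convergence in `K` to `H`.
    exact hE.liminf_ge _ _ (((WeakSpace.map j).continuous.tendsto _).comp hw)
  limsup_le v := by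
    obtain ⟨u, hu, hle⟩ := hE.limsup_le (j v)
    -- Recovery vectors of `j v` need not lie in the range of `j`. Projecting them by `j ∘ r` fixes
    -- the limit and does not raise the energy.
    refine ⟨fun k => r (u k), ?_, ?_⟩
    · have h1 := (r.continuous.tendsto _).comp hu
      rwa [hr] at h1
    · simp only [FormOn.energy_comap]
      exact (limsup_le_limsup (Eventually.of_forall fun k => (h k).energy_le (u k))).trans hle

end MoscoConverges

/-! ## Multiplication by an indicator function -/

section Indicator

variable {X : Type*} [MeasurableSpace X] {m : Measure X} {Y : Set X}

/-- Restriction to `Y`, as a bounded operator. -/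
def restrictCLM (m : Measure X) (Y : Set X) : Lp ℝ 2 m →L[ℝ] Lp ℝ 2 (m.restrict Y) :=
  LpToLpRestrictCLM X ℝ ℝ m 2 Y

theorem norm_extendByZero (hY : MeasurableSet Y) (w : Lp ℝ 2 (m.restrict Y)) :
    ‖extendByZero m hY w‖ = ‖w‖ := by
  rw [Lp.norm_def, Lp.norm_def, eLpNorm_congr_ae (coeFn_extendByZero hY w),
    eLpNorm_indicator_eq_eLpNorm_restrict hY]

/-- Extension by zero, as a bounded operator. -/
def extendByZeroCLM (m : Measure X) (hY : MeasurableSet Y) :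
    Lp ℝ 2 (m.restrict Y) →L[ℝ] Lp ℝ 2 m :=
  (extendByZero m hY).mkContinuous 1 fun w => by rw [one_mul, norm_extendByZero]

theorem restrictCLM_extendByZeroCLM (hY : MeasurableSet Y) (w : Lp ℝ 2 (m.restrict Y)) :
    restrictCLM m Y (extendByZeroCLM m hY w) = w := by
  refine Lp.ext ((LpToLpRestrictCLM_coeFn ℝ Y _).trans ?_)
  filter_upwards [ae_restrict_of_ae (coeFn_extendByZero hY w), ae_restrict_mem hY] with x h hx
  exact h.trans (Set.indicator_of_mem hx _)

theorem extendByZeroCLM_restrictCLM (hY : MeasurableSet Y) (u : Lp ℝ 2 m) :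
    (extendByZeroCLM m hY ∘L restrictCLM m Y) u = mulIndicator hY u := by
  refine Lp.ext ((coeFn_extendByZero hY _).trans ?_)
  exact (indicator_ae_eq_of_restrict hY (LpToLpRestrictCLM_coeFn ℝ Y u)).trans
    (coeFn_mulIndicator hY u).symm

theorem mulIndicator_mulIndicator (hY : MeasurableSet Y) (u : Lp ℝ 2 m) :
    mulIndicator hY (mulIndicator hY u) = mulIndicator hY u := by
  simp only [← extendByZeroCLM_restrictCLM hY, ContinuousLinearMap.comp_apply,
    restrictCLM_extendByZeroCLM]

theorem inner_mulIndicator (hY : MeasurableSet Y) (u v : Lp ℝ 2 m) :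
    ⟪mulIndicator hY u, v⟫ = ⟪u, mulIndicator hY v⟫ := by
  rw [L2.inner_def, L2.inner_def]
  refine integral_congr_ae ?_
  filter_upwards [coeFn_mulIndicator hY u, coeFn_mulIndicator hY v] with x hu hv
  rw [hu, hv]
  by_cases hx : x ∈ Y <;> simp [hx]

end Indicator

end

/-! ### The theorem, with `P` the multiplication by `1_Y`. -/

theorem mainTheorem5 {X : Type*} [MeasurableSpace X] (m : Measure X) [SigmaFinite m]
    (E : ℕ → DirichletForm m) (Einf : DirichletForm m)
    (hE : MoscoConverges (fun k => (E k).toFormOn) Einf.toFormOn)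
    (Y : Set X) (hY : MeasurableSet Y)
    (hinv : ∀ k, ∃ t : ℝ, 0 < t ∧ (E k).InvariantAt t hY) :
    (∀ t : ℝ, 0 < t → Einf.InvariantAt t hY) ∧
      MoscoConverges (fun k => (E k).part hY) (Einf.part hY) := by
  have hP := extendByZeroCLM_restrictCLM (m := m) hY
  set P := extendByZeroCLM m hY ∘L restrictCLM m Y
  have hPs : ∀ x y, ⟪P x, y⟫ = ⟪x, P y⟫ := fun x y => by
    rw [hP, hP, inner_mulIndicator]
  have hPP : ∀ x, P (P x) = P x := fun x => by
    rw [hP, hP, mulIndicator_mulIndicator]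
  -- The time `t` may depend on `k`; the splitting of the form no longer involves it.
  have hred : ∀ k, (E k).toFormOn.Reduces P := fun k => by
    obtain ⟨t, ht, h⟩ := hinv k
    refine (E k).reduces_of_resolvent_comm hPs hPP
      ((E k).resolvent_comm_of_semigroup_comm hPs hPP ht fun u => ?_)
    rw [hP, hP, h u]
  refine ⟨fun t ht u => ?_, ?_⟩
  · rw [← hP, ← hP]
    exact Einf.semigroup_comm_of_reduces hPs hPP (hE.reduces hPP hred) ht.le u
  · exact hE.comap (extendByZeroCLM m hY) (restrictCLM m Y) (restrictCLM_extendByZeroCLM hY) hred
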